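/- Let $d\ge 1$, let $\mathbb N=\{1,2,3,\dots\}$ and $p\in[0,1]$. Let $\{X_{\mathbf i}:\mathbf i\in\mathbb N^d\}$ be i.i.d. Bernoulli($p$) random variables, $\mathbb P(X_{\mathbf i}=1)=p=1-\mathbb P(X_{\mathbf i}=0)$, and let $\{\rho_{\mathbf i}:\mathbf i\in\mathbb N^d\}$ be i.i.d. random variables with values in $\{0,1,2,\dots\}$, the second family being independent of the first. Let $\rho$ denote a generic random variable with the distribution of $\rho_{\mathbf i}$. For $\mathbf i=(i_1,\dots,i_d)$ write $\mathbf i+[0,\rho_{\mathbf i}]^d=[i_1,i_1+\rho_{\mathbf i}]\times\cdots\times[i_d,i_d+\rho_{\mathbf i}]$, and let $$\mathbf D=\{\mathbf x\in\mathbb R^d:\ \text{there exist } \mathbf i\ne\mathbf j \text{ in } \mathbb N^d \text{ with } X_{\mathbf i}=X_{\mathbf j}=1 \text{ and } \mathbf x\in(\mathbf i+[0,\rho_{\mathbf i}]^d)\cap(\mathbf j+[0,\rho_{\mathbf j}]^d)\}.$$ Say that $\mathbb N^d$ is eventually doubly covered if there exists $\mathbf t\in\mathbb N^d$ such that $\mathbf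 t+\mathbb N^d\subseteq\mathbf D$. (i) Let $d=1$ and suppose that $l:=\liminf_{j\to\infty} j\,\mathbb P(\rho\ge j)>1$ and $L:=\limsup_{j\to\infty} j\,\mathbb P(\rho\ge j)<\infty$. Then $$\mathbb P(\mathbb N\text{ is eventually doubly covered})=\begin{cases}1&\text{if }p>1/l,\\ 0&\text{if }p<1/L.\end{cases}$$ (ii) Let $d\ge 2$ and $p>0$. If $\liminf_{j\to\infty} j\,\mathbb P(\rho\ge j)>0$, then $$\mathbb P(\mathbb N^d\text{ is eventually doubly covered})=1.$$ If $p<1$ and $\lim_{j\to\infty} j\,\mathbb P(\rho\ge j)=0$, then $$\mathbb P(\mathbb N^d\text{ is eventually doubly covered})=0.$$ -/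

import Mathlib

open MeasureTheory ProbabilityTheory Filter Topology
open scoped ENNReal unitInterval

/-- The lattice orthant `ℕ^d`, where `ℕ = {1, 2, 3, …}`. -/
abbrev Site (d : ℕ) : Type := Fin d → ℕ+

/-- The cube `i + [0, r]^d ⊆ ℝ^d`. -/
def cube {d : ℕ} (i : Site d) (r : ℕ) : Set (Fin d → ℝ) :=
  {x | ∀ k, (i k : ℝ) ≤ x k ∧ x k ≤ (i k : ℝ) + (r : ℝ)}

/-- The doubly covered region `D ⊆ ℝ^d` of a configuration: the points which lie in the cubes of
two different open sites. Site `i` is open when `X i = 1`, and `ρ i` is the side of its cube. -/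
def doublyCovered {d : ℕ} (X ρ : Site d → ℕ) : Set (Fin d → ℝ) :=
  {x | ∃ i j : Site d, i ≠ j ∧ X i = 1 ∧ X j = 1 ∧ x ∈ cube i (ρ i) ∩ cube j (ρ j)}

/-- `ℕ^d` is eventually doubly covered: `t + ℕ^d ⊆ D` for some `t ∈ ℕ^d`. -/
def EventuallyDoublyCovered {d : ℕ} (X ρ : Site d → ℕ) : Prop :=
  ∃ t : Site d, ∀ n : Site d, (fun k => (t k : ℝ) + (n k : ℝ)) ∈ doublyCovered X ρ

/-- The random configuration: `(X i)` are i.i.d. Bernoulli(`p`) with values in `{0, 1}`, `(ρ i)` are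
i.i.d. with law `ν` on the nonnegative integers, and the two families are independent. -/
structure IsCubeModel {Ω : Type*} [MeasurableSpace Ω] (P : Measure Ω) {d : ℕ} (p : I)
    (ν : Measure ℕ) (X ρ : Site d → Ω → ℕ) : Prop where
  measurable_X : ∀ i, Measurable (X i)
  measurable_ρ : ∀ i, Measurable (ρ i)
  law_X : ∀ i, HasLaw (X i) (bernoulliMeasure 1 0 p) P
  law_ρ : ∀ i, HasLaw (ρ i) ν P
  iIndep_X : iIndepFun X P
  iIndep_ρ : iIndepFun ρ P
  indep_X_ρ : IndepFun (fun ω i => X i ω) (fun ω i => ρ i ω) P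

/-- `j ↦ j · ℙ(ρ ≥ j)` for a variable `ρ` with law `ν`, valued in `[0, ∞]`. -/
noncomputable def scaledTail (ν : Measure ℕ) (j : ℕ) : ℝ≥0∞ := (j : ℝ≥0∞) * ν (Set.Ici j)

/-! ### Independence of pairs and of blocks. -/

section Independence

variable {Ω : Type*} [MeasurableSpace Ω] {P : Measure Ω}

/-! Coverage holds by Borel–Cantelli. Let `M` be the largest coordinate of `m`. A site `k` steps
behind `m` along that axis, and at most `k` steps behind along the others, covers `m` with
probability `p * ℙ(ρ ≥ k)`, at least `p * c / k`. Using `T` such sites for each `k` gives about `T *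
p * c * log M` expected coverings, so by Chernoff at most one occurs with probability of order `M ^
(-d * r)`, for some `r > 1` as soon as `T * p * c > d`. This is at most the product of the `m a ^
(-r)`, which is summable over the orthant. For `d = 1` only `T = 1` is available, whence the
threshold; for `d ≥ 2` a second axis makes `T` arbitrary (`ae_eventuallyDoublyCovered`).

Failure is a recurrence statement, and even single coverage fails. A point on a line at height `s`
parallel to an axis can be covered only from a strip of section `s ^ (d - 1)`. Merging each slice of
the strip into one interval gives i.i.d. lengths with tail at most `s ^ (d - 1) * p * ℙ(ρ ≥ k)`. If
this is at most `1 / k`, uncovered points form a recurrent renewal process (`ae_exists_uncovered`).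
-/

/-- Two independent families of independent variables combine to a family of independent pairs. -/
theorem iIndepFun_prodMk_of_indepFun {ι α β : Type*} [MeasurableSpace α] [MeasurableSpace β]
    {X : ι → Ω → α} {Y : ι → Ω → β} (hX : ∀ i, Measurable (X i)) (hY : ∀ i, Measurable (Y i))
    (iX : iIndepFun X P) (iY : iIndepFun Y P)
    (h : IndepFun (fun ω i => X i ω) (fun ω i => Y i ω) P) :
    iIndepFun (fun i ω => (X i ω, Y i ω)) P := by
  let R : Set (Set (α × β)) :=
    Set.image2 (· ×ˢ ·) {s : Set α | MeasurableSet s} {t : Set β | MeasurableSet t}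
  refine iIndepSets.iIndep (fun i => ((hX i).prodMk (hY i)).comap_le)
    (fun i => {s | ∃ t ∈ R, (fun ω => (X i ω, Y i ω)) ⁻¹' t = s})
    (fun i => isPiSystem_prod.comap _) (fun i => ?_) ?_
  · rw [← generateFrom_prod, MeasurableSpace.comap_generateFrom]
    rfl
  · rw [iIndepSets_iff]
    intro S f hf
    choose! t ht htf using hf
    choose! A hA B hB hAB using ht
    have e : ∀ i ∈ S, f i = X i ⁻¹' A i ∩ Y i ⁻¹' B i := by
      intro i hi
      rw [← htf i hi, ← hAB i hi]
      rfl
    have e1 : (⋂ i ∈ S, f i) = (⋂ i ∈ S, X i ⁻¹' A i) ∩ (⋂ i ∈ S, Y i ⁻¹' B i) := by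
      ext ω
      simp only [Set.mem_iInter, Set.mem_inter_iff]
      constructor
      · intro H
        refine ⟨fun i hi => ?_, fun i hi => ?_⟩
        · exact ((e i hi) ▸ H i hi).1
        · exact ((e i hi) ▸ H i hi).2
      · rintro ⟨H1, H2⟩ i hi
        rw [e i hi]
        exact ⟨H1 i hi, H2 i hi⟩
    have pair : ∀ U V : Set Ω, (∃ u, MeasurableSet u ∧ (fun ω i => X i ω) ⁻¹' u = U) →
        (∃ v, MeasurableSet v ∧ (fun ω i => Y i ω) ⁻¹' v = V) → P (U ∩ V) = P U * P V := by
      rintro _ _ ⟨u, hu, rfl⟩ ⟨v, hv, rfl⟩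
      exact h.measure_inter_preimage_eq_mul _ _ hu hv
    rw [e1, pair _ _ ⟨⋂ i ∈ S, (fun x => x i) ⁻¹' A i, ?_, ?_⟩
        ⟨⋂ i ∈ S, (fun x => x i) ⁻¹' B i, ?_, ?_⟩,
      iX.measure_inter_preimage_eq_mul S (fun i hi => hA i hi),
      iY.measure_inter_preimage_eq_mul S (fun i hi => hB i hi), ← Finset.prod_mul_distrib]
    · refine Finset.prod_congr rfl fun i hi => ?_
      rw [e i hi]
      refine (pair _ _ ⟨(fun x => x i) ⁻¹' A i, measurable_pi_apply i (hA i hi), rfl⟩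
        ⟨(fun x => x i) ⁻¹' B i, measurable_pi_apply i (hB i hi), rfl⟩).symm
    · exact Finset.measurableSet_biInter _ fun i hi => measurable_pi_apply i (hA i hi)
    · simp [Set.preimage_iInter, Set.preimage_preimage]
    · exact Finset.measurableSet_biInter _ fun i hi => measurable_pi_apply i (hB i hi)
    · simp [Set.preimage_iInter, Set.preimage_preimage]

/-- Grouping an independent identically distributed family into blocks. -/
theorem iIndepFun_curry [IsProbabilityMeasure P] {ι κ α : Type*} [MeasurableSpace α]
    {Z : ι × κ → Ω → α} {μ : Measure α} [IsProbabilityMeasure μ]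
    (hZ : ∀ i, Measurable (Z i)) (hμ : ∀ i, P.map (Z i) = μ) (h : iIndepFun Z P) :
    iIndepFun (fun n ω b => Z (n, b) ω) P ∧
      ∀ n, P.map (fun ω b => Z (n, b) ω) = Measure.infinitePi fun _ : κ => μ := by
  have h2 : ∀ n, P.map (fun ω b => Z (n, b) ω) = Measure.infinitePi fun _ : κ => μ := by
    intro n
    have := h.precomp (g := fun b => (n, b)) (fun a b hab => by simpa using hab)
    have := (iIndepFun_iff_map_fun_eq_infinitePi_map (fun b => hZ (n, b))).1 this
    simpa [hμ] using this
  refine ⟨?_, h2⟩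
  rw [iIndepFun_iff_map_fun_eq_infinitePi_map (by fun_prop)]
  simp_rw [h2]
  have h3 := (iIndepFun_iff_map_fun_eq_infinitePi_map hZ).1 h
  simp_rw [hμ] at h3
  have h4 := Measure.infinitePi_map_curry (ι := ι) (κ := κ) (fun _ _ => μ)
  rw [← h4, ← h3, Measure.map_map (by fun_prop) (by fun_prop)]
  rfl

end Independence

/-! ### One-dimensional coverage as a renewal process. -/

section Renewal

variable {Ω : Type*} [MeasurableSpace Ω] {P : Measure Ω} [IsProbabilityMeasure P]

/-- If `g k ≥ 1 - 1 / k` eventually and `g > 0`, the partial products of `g` decay at most like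
`1 / n`, hence are not summable. -/
theorem not_summable_prod_range_succ {g : ℕ → ℝ} (h0 : ∀ k, 0 < g k)
    (h1 : ∀ᶠ k : ℕ in atTop, 1 - 1 / (k : ℝ) ≤ g k) :
    ¬ Summable fun n => ∏ k ∈ Finset.range (n + 1), g k := by
  obtain ⟨K, hK⟩ := eventually_atTop.1 (h1.and (eventually_ge_atTop 2))
  have hK2 : 2 ≤ K := (hK K le_rfl).2
  have hK2' : (2 : ℝ) ≤ K := by exact_mod_cast hK2
  -- The factors `1 - 1 / k = (k - 1) / k` telescope from `K` on, which gives the lower bound `c /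
  -- (n - 1)`.
  set c := (∏ k ∈ Finset.range K, g k) * ((K : ℝ) - 1) with hc
  have hc0 : 0 < c := mul_pos (Finset.prod_pos fun k _ => h0 k) (by linarith)
  have key : ∀ n, K ≤ n → c / ((n : ℝ) - 1) ≤ ∏ k ∈ Finset.range n, g k := by
    intro n hn
    induction n, hn using Nat.le_induction with
    | base =>
      rw [hc, mul_div_assoc, div_self (by linarith), mul_one]
    | succ n hn ih =>
      have hn' : (2 : ℝ) ≤ n := by exact_mod_cast hK2.trans hn
      rw [Finset.prod_range_succ]
      have e : c / (((n + 1 : ℕ) : ℝ) - 1) = c / ((n : ℝ) - 1) * (1 - 1 / (n : ℝ)) := by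
        have : (n : ℝ) - 1 ≠ 0 := by linarith
        have : (n : ℝ) ≠ 0 := by linarith
        push_cast
        rw [add_sub_cancel_right]
        field_simp
      rw [e]
      have : 1 / (n : ℝ) ≤ 1 := by
        rw [div_le_one (by linarith)]
        linarith
      exact mul_le_mul ih (hK n hn).1 (by linarith) (Finset.prod_nonneg fun k _ => (h0 k).le)
  intro hs
  have h2 : Summable fun n : ℕ => c * (1 / ((n + K : ℕ) : ℝ)) := by
    refine Summable.of_nonneg_of_le (fun n => by positivity) (fun n => ?_)
      ((summable_nat_add_iff K).2 hs)
    have := key (n + K + 1) (by omega)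
    push_cast at this ⊢
    simpa [div_eq_mul_inv] using this
  have h3 := (summable_mul_left_iff hc0.ne').1 h2
  exact Real.not_summable_one_div_natCast ((summable_nat_add_iff K).1 h3)

/-- **Recurrence.** Let the intervals `[j, j + R j)` have i.i.d. lengths with
`k · ℙ(R > k) ≤ 1` for large `k`. Then almost surely infinitely many points are uncovered. -/
theorem ae_exists_uncovered {R : ℕ → Ω → ℕ} {η : Measure ℕ} [IsProbabilityMeasure η]
    (hm : ∀ n, Measurable (R n)) (hlaw : ∀ n, P.map (R n) = η) (hind : iIndepFun R P)
    (h0 : 0 < η {0}) (h1 : ∀ᶠ k : ℕ in atTop, (k : ℝ) * η.real (Set.Ioi k) ≤ 1) :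
    ∀ᵐ ω ∂P, ∀ N, ∃ n, N ≤ n ∧ ∀ j ≤ n, R j ω + j ≤ n := by
  -- On `E n` the point `n` is uncovered; on `F n` the intervals started from `n` on already cover
  -- all of `[n, ∞)`. The probability `q` of `F n` does not depend on `n`.
  set E : ℕ → Set Ω := fun n => {ω | ∀ j ≤ n, R j ω + j ≤ n} with hE
  set S : Set (ℕ → ℕ) := {r | ∀ m, ∃ j ≤ m, m < r j + j} with hS
  set F : ℕ → Set Ω := fun n => (fun ω j => R (n + j) ω) ⁻¹' S with hF
  have hSm : MeasurableSet S := by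
    have : S = ⋂ m, ⋃ j, ⋃ (_ : j ≤ m), {r : ℕ → ℕ | m < r j + j} := by
      ext; simp [hS]
    rw [this]
    exact MeasurableSet.iInter fun m => MeasurableSet.iUnion fun j => MeasurableSet.iUnion fun _ =>
      (show Measurable fun r : ℕ → ℕ => r j from measurable_pi_apply j)
        (MeasurableSet.of_discrete (s := {a : ℕ | m < a + j}))
  have hEm : ∀ n, MeasurableSet[⨆ i ∈ Set.Iic n, MeasurableSpace.comap (R i) inferInstance]
      (E n) := by
    intro n
    have : E n = ⋂ j ∈ Set.Iic n, R j ⁻¹' {r | r + j ≤ n} := by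
      ext; simp [hE]
    rw [this]
    refine MeasurableSet.biInter (Set.to_countable _) fun j hj => ?_
    exact le_iSup₂ (f := fun i (_ : i ∈ Set.Iic n) => MeasurableSpace.comap (R i) inferInstance) j hj
      _ ⟨_, MeasurableSet.of_discrete, rfl⟩
  have hFm : ∀ n, MeasurableSet[⨆ i ∈ Set.Ici n, MeasurableSpace.comap (R i) inferInstance]
      (F n) := by
    intro n
    have : F n = ⋂ m, ⋃ j, ⋃ (_ : j ≤ m), R (n + j) ⁻¹' {r : ℕ | m < r + j} := by
      ext; simp [hF, hS]
    rw [this]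
    refine MeasurableSet.iInter fun m => MeasurableSet.iUnion fun j => MeasurableSet.iUnion fun _ => ?_
    exact le_iSup₂ (f := fun i (_ : i ∈ Set.Ici n) => MeasurableSpace.comap (R i) inferInstance)
      (n + j) (by simp) _ ⟨_, MeasurableSet.of_discrete, rfl⟩
  have hle : ∀ i, MeasurableSpace.comap (R i) inferInstance ≤ ‹MeasurableSpace Ω› :=
    fun i => (hm i).comap_le
  have hFl : ∀ n, P (F n) = Measure.infinitePi (fun _ : ℕ => η) S := by
    intro n
    have h2 := hind.precomp (g := fun j => n + j) (fun a b hab => by simpa using hab)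
    have h3 := (iIndepFun_iff_map_fun_eq_infinitePi_map (fun j => hm (n + j))).1 h2
    simp only [hlaw] at h3
    rw [← h3, Measure.map_apply (by fun_prop) hSm]
  set q := Measure.infinitePi (fun _ : ℕ => η) S with hq
  have hEF : ∀ n, P (E n ∩ F (n + 1)) = P (E n) * q := by
    intro n
    have hI := indep_iSup_of_disjoint hle hind.iIndep (S := Set.Iic n) (T := Set.Ici (n + 1))
      (Set.disjoint_left.2 fun i hi hi' => by
        simp only [Set.mem_Iic, Set.mem_Ici] at hi hi'; omega)
    rw [Indep_iff] at hI
    rw [hI _ _ (hEm n) (hFm (n + 1)), hFl]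
  have hEmeas : ∀ n, MeasurableSet (E n) := fun n => iSup₂_le (fun i _ => hle i) _ (hEm n)
  have hFmeas : ∀ n, MeasurableSet (F n) := fun n => iSup₂_le (fun i _ => hle i) _ (hFm n)
  -- On `E n ∩ F (n + 1)` the last uncovered point is `n`. Disjointness gives `(∑ P (E n)) * q ≤ 1`,
  -- so divergence of the sum forces `q = 0`.
  have hdisj : Pairwise (Function.onFun Disjoint fun n => E n ∩ F (n + 1)) := by
    refine (pairwise_disjoint_on _).2 fun n m hnm => Set.disjoint_left.2 ?_
    rintro ω ⟨-, h3⟩ ⟨h2, -⟩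
    obtain ⟨j, hj, hlt⟩ := h3 (m - (n + 1))
    have := h2 (n + 1 + j) (by omega)
    simp only at hlt
    omega
  have hsum : (∑' n, P (E n)) * q ≤ 1 := by
    rw [← ENNReal.tsum_mul_right]
    simp_rw [← hEF]
    rw [← measure_iUnion hdisj fun n => (hEmeas n).inter (hFmeas _)]
    exact prob_le_one
  have hPE : ∀ n, P (E n) = ENNReal.ofReal (∏ k ∈ Finset.range (n + 1), η.real (Set.Iic k)) := by
    intro n
    have e : E n = ⋂ j ∈ Finset.range (n + 1), R j ⁻¹' Set.Iic (n - j) := by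
      ext ω
      simp only [hE, Set.mem_ofPred_eq, Finset.mem_range, Set.mem_iInter, Set.mem_preimage,
        Set.mem_Iic]
      exact ⟨fun H j hj => by have := H j (by omega); omega,
        fun H j hj => by have := H j (by omega); omega⟩
    rw [e, hind.measure_inter_preimage_eq_mul _ fun _ _ => MeasurableSet.of_discrete,
      ENNReal.ofReal_prod_of_nonneg fun _ _ => measureReal_nonneg,
      ← Finset.prod_range_reflect]
    refine Finset.prod_congr rfl fun j hj => ?_
    simp only [Finset.mem_range] at hj
    rw [← Measure.map_apply (hm _) MeasurableSet.of_discrete, hlaw, measureReal_def,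
      ENNReal.ofReal_toReal (measure_ne_top _ _)]
    congr 2
    omega
  have htop : ∑' n, P (E n) = ∞ := by
    by_contra hne
    refine not_summable_prod_range_succ (g := fun k => η.real (Set.Iic k)) (fun k => ?_) ?_ ?_
    · refine ENNReal.toReal_pos (h0.trans_le (measure_mono (by simp))).ne' (measure_ne_top _ _)
    · filter_upwards [h1, eventually_gt_atTop 0] with k hk hk0
      have hk0' : (0 : ℝ) < k := by exact_mod_cast hk0
      have : η.real (Set.Iic k) = 1 - η.real (Set.Ioi k) := by
        rw [← Set.compl_Iic, probReal_compl_eq_one_sub MeasurableSet.of_discrete]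
        ring
      rw [this, sub_le_sub_iff_left, le_div_iff₀ hk0']
      linarith
    · simp_rw [hPE] at hne
      refine (ENNReal.summable_toReal hne).congr fun n => ?_
      rw [ENNReal.toReal_ofReal (Finset.prod_nonneg fun _ _ => measureReal_nonneg)]
  have hq0 : q = 0 := by
    by_contra hne
    rw [htop, ENNReal.top_mul hne] at hsum
    simp at hsum
  have hae : ∀ᵐ ω ∂P, ∀ n, ω ∉ F n := by
    rw [ae_all_iff]
    intro n
    rw [← measure_eq_zero_iff_ae_notMem, hFl, hq0]
  filter_upwards [hae] with ω hω
  intro N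
  have step : ∀ n, ∃ m, ∀ j ≤ m, R (n + j) ω + j ≤ m := by
    intro n
    have := hω n
    simp only [hF, hS, Set.mem_preimage, Set.mem_ofPred_eq, not_forall, not_exists, not_and,
      not_lt] at this
    exact this
  -- Renewal: intervals started up to an uncovered `n` end by `n`, so a point left uncovered by
  -- those started from `n + 1` on is truly uncovered.
  induction N with
  | zero =>
    obtain ⟨m, hm⟩ := step 0
    exact ⟨m, by simp, by simpa using hm⟩
  | succ N ih =>
    obtain ⟨n, hn, hnE⟩ := ih
    obtain ⟨m, hm⟩ := step (n + 1)
    refine ⟨n + 1 + m, by omega, fun j hj => ?_⟩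
    by_cases hjn : j ≤ n
    · have := hnE j hjn
      omega
    · obtain ⟨i, rfl⟩ := Nat.exists_eq_add_of_le (show n + 1 ≤ j by omega)
      have := hm i (by omega)
      omega

end Renewal

/-! ### Exponential bound for at most one success. -/

section Chernoff

variable {Ω : Type*} [MeasurableSpace Ω] {P : Measure Ω} [IsProbabilityMeasure P]

/-- A Chernoff bound: among independent events, the probability that at most one occurs. -/
theorem measureReal_at_most_one_le {ι α : Type*} [Fintype ι] [MeasurableSpace α]
    {Z : ι → Ω → α} (hZ : ∀ i, Measurable (Z i)) (h : iIndepFun Z P) {B : ι → Set α}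
    (hB : ∀ i, MeasurableSet (B i)) {θ : ℝ} (hθ : 0 < θ) (hθ1 : θ ≤ 1) :
    P.real {ω | ∀ i j, Z i ω ∈ B i → Z j ω ∈ B j → i = j} ≤
      θ⁻¹ * Real.exp (-((1 - θ) * ∑ i, P.real (Z i ⁻¹' B i))) := by
  classical
  -- The product of the `f i` is `θ ^ N`, with `N` the number of events that occur. It is at least
  -- `θ` when `N ≤ 1`, so Markov's inequality applies.
  let f : (i : ι) → α → ℝ := fun i => (B i).piecewise (fun _ => θ) (fun _ => 1)
  have hf : ∀ i, Measurable (f i) := fun i =>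
    Measurable.piecewise (hB i) measurable_const measurable_const
  have hfθ : ∀ i z, θ ≤ f i z := by
    intro i z
    by_cases hz : z ∈ B i <;> simp [f, hz, hθ1]
  have hf1 : ∀ i z, f i z ≤ 1 := by
    intro i z
    by_cases hz : z ∈ B i <;> simp [f, hz, hθ1]
  have hf0 : ∀ i z, 0 ≤ f i z := fun i z => hθ.le.trans (hfθ i z)
  have hI : ∀ i, ∫ ω, f i (Z i ω) ∂P ≤ Real.exp (-((1 - θ) * P.real (Z i ⁻¹' B i))) := by
    intro i
    have hmeas : MeasurableSet (Z i ⁻¹' B i) := hZ i (hB i)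
    have e : (fun ω => f i (Z i ω)) =
        fun ω => 1 - (Z i ⁻¹' B i).indicator (fun _ => (1 - θ)) ω := by
      ext ω
      by_cases hz : Z i ω ∈ B i <;> simp [f, hz]
    rw [e, integral_sub (integrable_const _) ((integrable_const _).indicator hmeas),
      integral_indicator_const _ hmeas]
    simp only [integral_const, probReal_univ, smul_eq_mul, mul_one]
    have := Real.add_one_le_exp (-((1 - θ) * P.real (Z i ⁻¹' B i)))
    linarith
  have hmain := h.integral_fun_prod_comp (f := f) (fun i => (hZ i).aemeasurable)
    (fun i => (hf i).aestronglyMeasurable)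
  have hint : Integrable (fun ω => ∏ i, f i (Z i ω)) P := by
    refine Integrable.of_bound (C := 1)
      (Finset.measurable_fun_prod _ fun i _ => (hf i).comp (hZ i)).aestronglyMeasurable
      (ae_of_all _ fun ω => ?_)
    rw [Real.norm_of_nonneg (Finset.prod_nonneg fun i _ => hf0 i _)]
    exact Finset.prod_le_one (fun i _ => hf0 i _) fun i _ => hf1 i _
  have hmk := mul_meas_ge_le_integral_of_nonneg
    (ae_of_all P fun ω => Finset.prod_nonneg fun i _ => hf0 i (Z i ω)) hint θ
  have hsub : {ω | ∀ i j, Z i ω ∈ B i → Z j ω ∈ B j → i = j} ⊆ {ω | θ ≤ ∏ i, f i (Z i ω)} := by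
    intro ω hω
    simp only [Set.mem_ofPred_eq] at hω ⊢
    by_cases hex : ∃ i, Z i ω ∈ B i
    · obtain ⟨i, hi⟩ := hex
      rw [Fintype.prod_eq_single i]
      · exact hfθ i _
      · intro j hj
        have : Z j ω ∉ B j := fun hj' => hj (hω j i hj' hi)
        simp [f, this]
    · have : ∀ i, f i (Z i ω) = 1 := fun i => by
        have : Z i ω ∉ B i := fun hi => hex ⟨i, hi⟩
        simp [f, this]
      simp [this, hθ1]
  rw [hmain] at hmk
  have h2 : θ * P.real {ω | ∀ i j, Z i ω ∈ B i → Z j ω ∈ B j → i = j} ≤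
      Real.exp (-((1 - θ) * ∑ i, P.real (Z i ⁻¹' B i))) := by
    calc _ ≤ θ * P.real {ω | θ ≤ ∏ i, f i (Z i ω)} :=
          mul_le_mul_of_nonneg_left (measureReal_mono hsub) hθ.le
      _ ≤ _ := hmk
      _ ≤ ∏ i, Real.exp (-((1 - θ) * P.real (Z i ⁻¹' B i))) :=
          Finset.prod_le_prod (fun i _ => integral_nonneg fun ω => hf0 i _) fun i _ => hI i
      _ = _ := by rw [← Real.exp_sum, Finset.mul_sum, Finset.sum_neg_distrib]
  rw [inv_mul_eq_div, le_div_iff₀ hθ]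
  linarith

end Chernoff

/-! ### Series estimates. -/

/-- The sum over a power is the power of the sum. -/
theorem ENNReal.tsum_pi_prod {α : Type*} (f : α → ℝ≥0∞) (d : ℕ) :
    ∑' m : Fin d → α, ∏ c, f (m c) = (∑' a, f a) ^ d := by
  induction d with
  | zero => simp
  | succ d ih =>
    rw [← (Fin.consEquiv fun _ => α).tsum_eq, ENNReal.tsum_prod']
    simp only [Fin.consEquiv_apply, Fin.prod_univ_succ, Fin.cons_zero, Fin.cons_succ]
    simp_rw [ENNReal.tsum_mul_left, ih, ENNReal.tsum_mul_right]
    rw [pow_succ']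

theorem ENNReal.tsum_pnat_rpow_ne_top {r : ℝ} (hr : 1 < r) :
    ∑' n : ℕ+, ENNReal.ofReal ((n : ℝ) ^ (-r)) ≠ ∞ := by
  have h1 : Summable fun n : ℕ => (n : ℝ) ^ (-r) := Real.summable_nat_rpow.2 (by linarith)
  have h2 : Summable fun n : ℕ+ => ((n : ℕ) : ℝ) ^ (-r) :=
    h1.comp_injective PNat.coe_injective
  exact h2.tsum_ofReal_ne_top

/-- A lower bound for a stretch of the harmonic series. -/
theorem log_sub_log_le_sum_Ico {K : ℕ} (hK : 0 < K) (M : ℕ) (hM : K ≤ M) :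
    Real.log M - Real.log K ≤ ∑ k ∈ Finset.Ico K M, 1 / (k : ℝ) := by
  induction M, hM using Nat.le_induction with
  | base => simp
  | succ n hn ih =>
    rw [Finset.sum_Ico_succ_top hn]
    have hn0 : (0 : ℝ) < n := by exact_mod_cast hK.trans_le hn
    have h1 := Real.log_le_sub_one_of_pos (show 0 < ((n + 1 : ℕ) : ℝ) / n by positivity)
    rw [Real.log_div (by positivity) hn0.ne'] at h1
    have h2 : ((n + 1 : ℕ) : ℝ) / n - 1 = 1 / n := by
      push_cast
      field_simp
      ring
    linarith

/-! ### Almost sure double coverage. -/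

/-- The open site `i` covers the lattice point `m`. -/
def SiteCovers {d : ℕ} (X ρ : Site d → ℕ) (i m : Site d) : Prop :=
  X i = 1 ∧ ∀ k, (i k : ℕ) ≤ m k ∧ (m k : ℕ) ≤ i k + ρ i

theorem add_mem_doublyCovered_iff {d : ℕ} {X ρ : Site d → ℕ} {t n : Site d} :
    (fun k => (t k : ℝ) + (n k : ℝ)) ∈ doublyCovered X ρ ↔
      ∃ i j, i ≠ j ∧ SiteCovers X ρ i (t + n) ∧ SiteCovers X ρ j (t + n) := by
  have h : ∀ i, (fun k => (t k : ℝ) + (n k : ℝ)) ∈ cube i (ρ i) ↔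
      ∀ k, (i k : ℕ) ≤ (t + n) k ∧ ((t + n) k : ℕ) ≤ i k + ρ i := by
    intro i
    refine forall_congr' fun k => ?_
    simp only [Pi.add_apply, PNat.add_coe]
    norm_cast
  simp only [doublyCovered, SiteCovers, Set.mem_ofPred_eq, Set.mem_inter_iff, h]
  exact exists₂_congr fun i j => by tauto

namespace IsCubeModel

variable {Ω : Type*} [MeasurableSpace Ω] {P : Measure Ω}
  {d : ℕ} {p : I} {ν : Measure ℕ} {X ρ : Site d → Ω → ℕ}

theorem measurable_pair (h : IsCubeModel P p ν X ρ) (i : Site d) :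
    Measurable fun ω => (X i ω, ρ i ω) :=
  (h.measurable_X i).prodMk (h.measurable_ρ i)

theorem iIndepFun_pair (h : IsCubeModel P p ν X ρ) : iIndepFun (fun i ω => (X i ω, ρ i ω)) P :=
  iIndepFun_prodMk_of_indepFun h.measurable_X h.measurable_ρ h.iIndep_X h.iIndep_ρ h.indep_X_ρ

theorem map_pair [IsProbabilityMeasure P] (h : IsCubeModel P p ν X ρ) (i : Site d) :
    P.map (fun ω => (X i ω, ρ i ω)) = (bernoulliMeasure 1 0 p).prod ν := by
  have hi : IndepFun (X i) (ρ i) P :=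
    h.indep_X_ρ.comp (measurable_pi_apply i) (measurable_pi_apply i)
  rw [(indepFun_iff_map_prod_eq_prod_map_map (h.measurable_X i).aemeasurable
    (h.measurable_ρ i).aemeasurable).1 hi, (h.law_X i).map_eq, (h.law_ρ i).map_eq]

theorem _root_.bernoulliMeasure_prod_real (p : I) (ν : Measure ℕ) [IsProbabilityMeasure ν]
    (s : Set ℕ) : ((bernoulliMeasure 1 0 p).prod ν).real ({1} ×ˢ s) = p * ν.real s := by
  rw [measureReal_prod_prod]
  congr 1
  rw [bernoulliMeasure_real_apply_of_mem_of_notMem] <;> simp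

theorem measureReal_pair [IsProbabilityMeasure P] [IsProbabilityMeasure ν]
    (h : IsCubeModel P p ν X ρ) (i : Site d) (s : Set ℕ) :
    P.real ((fun ω => (X i ω, ρ i ω)) ⁻¹' ({1} ×ˢ s)) = p * ν.real s := by
  rw [← bernoulliMeasure_prod_real, ← h.map_pair i,
    map_measureReal_apply (h.measurable_pair i) MeasurableSet.of_discrete]

/-- Chernoff applied to the `T * (M - K)` sites behind `m`. The bound is a product over coordinates
so that it can be summed over `m`; `T ≤ K` keeps the sideways offset inside the orthant and below
the offset along the main axis. -/
theorem measureReal_not_doublyCovered_le [IsProbabilityMeasure P] [IsProbabilityMeasure ν]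
    (h : IsCubeModel P p ν X ρ) (hd : 0 < d) {T : ℕ}
    (hT : T = 1 ∨ 2 ≤ d) {c : ℝ} (hc0 : 0 ≤ c) {K : ℕ} (hK : 0 < K) (hTK : T ≤ K)
    (hc : ∀ k, K ≤ k → c ≤ k * ν.real (Set.Ici k)) {θ : ℝ} (hθ : 0 < θ) (hθ1 : θ ≤ 1)
    {r : ℝ} (hr : 0 ≤ r) (hrT : d * r ≤ (1 - θ) * (T * p * c)) (m : Site d) (hm : ∀ a, K ≤ m a) :
    P.real {ω | ¬ ∃ i j, i ≠ j ∧ SiteCovers (fun i => X i ω) (fun i => ρ i ω) i m ∧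
        SiteCovers (fun i => X i ω) (fun i => ρ i ω) j m} ≤
      θ⁻¹ * (K : ℝ) ^ (d * r) * ∏ a, (m a : ℝ) ^ (-r) := by
  classical
  have : Nonempty (Fin d) := ⟨⟨0, hd⟩⟩
  obtain ⟨k0, hk0⟩ := Finite.exists_max fun a => m a
  -- With `T = 1` the sideways offset is always `0`, so no second axis is needed.
  obtain ⟨k1, hk1⟩ : ∃ k1 : Fin d, T = 1 ∨ k1 ≠ k0 := by
    rcases hT with hT | hT
    · exact ⟨k0, Or.inl hT⟩
    · have : Nontrivial (Fin d) := Fin.nontrivial_iff_two_le.2 hT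
      obtain ⟨k1, hk1⟩ := exists_ne k0
      exact ⟨k1, Or.inr hk1⟩
  have hp0 : (0 : ℝ) ≤ p := p.2.1
  set M : ℕ := (m k0).val with hM
  let τ := Fin T × (Finset.Ico K M)
  let off : τ → Fin d → ℕ := fun x a => if a = k0 then x.2 else if a = k1 then x.1 else 0
  have hoff_lt : ∀ x a, off x a < m a := by
    intro x a
    have h1 := Finset.mem_Ico.1 x.2.2
    have h2 := x.1.2
    have h3 := hm a
    simp only [off]
    split_ifs with ha
    · subst ha; exact h1.2
    · omega
    · omega
  have hoff_le : ∀ x a, off x a ≤ x.2 := by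
    intro x a
    have h1 := Finset.mem_Ico.1 x.2.2
    have h2 := x.1.2
    simp only [off]
    split_ifs <;> omega
  let e : τ → Site d := fun x a => ⟨m a - off x a, Nat.sub_pos_of_lt (hoff_lt x a)⟩
  have he : ∀ x a, (e x a : ℕ) + off x a = m a := fun x a => Nat.sub_add_cancel (hoff_lt x a).le
  have he_inj : Function.Injective e := by
    intro x y hxy
    have h1 : ∀ a, off x a = off y a := by
      intro a
      have h2 := he x a
      have h3 := he y a
      rw [hxy] at h2
      omega
    have h2 := h1 k0
    simp only [off, if_true] at h2
    refine Prod.ext ?_ (Subtype.ext h2)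
    rcases hk1 with rfl | hk1
    · exact Subsingleton.elim _ _
    · have h3 := h1 k1
      simp only [off, if_neg hk1, if_true] at h3
      exact Fin.ext h3
  have hcov : ∀ x ω, (X (e x) ω, ρ (e x) ω) ∈ ({1} ×ˢ Set.Ici (x.2 : ℕ) : Set (ℕ × ℕ)) →
      SiteCovers (fun i => X i ω) (fun i => ρ i ω) (e x) m := by
    rintro x ω ⟨h1, h2⟩
    refine ⟨h1, fun a => ?_⟩
    have h3 := he x a
    have h4 := hoff_le x a
    simp only [Set.mem_Ici] at h2
    constructor
    · omega
    · show (m a : ℕ) ≤ e x a + ρ (e x) ω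
      omega
  have hch := measureReal_at_most_one_le (fun x => h.measurable_pair (e x))
    (h.iIndepFun_pair.precomp he_inj) (B := fun x => {1} ×ˢ Set.Ici (x.2 : ℕ))
    (fun x => MeasurableSet.of_discrete) hθ hθ1
  refine (measureReal_mono ?_).trans (hch.trans ?_)
  · intro ω hω x y hx hy
    by_contra hxy
    exact hω ⟨e x, e y, he_inj.ne hxy, hcov x ω hx, hcov y ω hy⟩
  simp_rw [h.measureReal_pair]
  have hMK : K ≤ M := hm k0
  have hK0 : (0 : ℝ) < K := by exact_mod_cast hK
  have hM0 : (0 : ℝ) < M := by exact_mod_cast hK.trans_le hMK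
  have hlog : 0 ≤ Real.log M - Real.log K :=
    sub_nonneg.2 (Real.log_le_log hK0 (by exact_mod_cast hMK))
  have hsum : (T : ℝ) * p * c * (Real.log M - Real.log K) ≤
      ∑ x : τ, (p : ℝ) * ν.real (Set.Ici (x.2 : ℕ)) := by
    rw [Fintype.sum_prod_type]
    simp only [Finset.sum_const, Finset.card_univ, Fintype.card_fin, nsmul_eq_mul]
    rw [Finset.sum_coe_sort (Finset.Ico K M) fun k => (p : ℝ) * ν.real (Set.Ici k),
      ← Finset.mul_sum, mul_assoc, mul_assoc, ← mul_assoc (p : ℝ)]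
    refine mul_le_mul_of_nonneg_left ?_ (Nat.cast_nonneg T)
    rw [mul_assoc]
    refine mul_le_mul_of_nonneg_left ?_ hp0
    refine (mul_le_mul_of_nonneg_left (log_sub_log_le_sum_Ico hK M hMK) hc0).trans ?_
    rw [Finset.mul_sum]
    refine Finset.sum_le_sum fun k hk => ?_
    have hkK := (Finset.mem_Ico.1 hk).1
    have hk0 : (0 : ℝ) < k := by exact_mod_cast hK.trans_le hkK
    rw [mul_one_div, div_le_iff₀ hk0, mul_comm]
    exact hc k hkK
  rw [mul_assoc]
  refine mul_le_mul_of_nonneg_left ?_ (inv_nonneg.2 hθ.le)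
  -- The decay `M ^ (-d * r)` is shared equally among the `d` coordinates, each at most `M`.
  have h1 : Real.exp (-(d * r * (Real.log M - Real.log K))) =
      (K : ℝ) ^ (d * r) * ∏ _a : Fin d, (M : ℝ) ^ (-r) := by
    rw [Finset.prod_const, Finset.card_univ, Fintype.card_fin, ← Real.rpow_mul_natCast hM0.le,
      Real.rpow_def_of_pos hK0, Real.rpow_def_of_pos hM0, ← Real.exp_add]
    congr 1
    ring
  calc _ ≤ Real.exp (-(d * r * (Real.log M - Real.log K))) := by
        refine Real.exp_le_exp.2 (neg_le_neg ?_)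
        calc d * r * (Real.log M - Real.log K)
            ≤ (1 - θ) * (T * p * c) * (Real.log M - Real.log K) := by gcongr
          _ = (1 - θ) * (T * p * c * (Real.log M - Real.log K)) := by ring
          _ ≤ _ := mul_le_mul_of_nonneg_left hsum (by linarith)
    _ ≤ _ := by
        rw [h1]
        refine mul_le_mul_of_nonneg_left (Finset.prod_le_prod (fun _ _ => by positivity)
          fun a _ => ?_) (by positivity)
        refine Real.rpow_le_rpow_of_nonpos (by exact_mod_cast (m a).pos) ?_ (by linarith)
        exact_mod_cast hk0 a

theorem ae_eventuallyDoublyCovered [IsProbabilityMeasure P] [IsProbabilityMeasure ν]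
    (h : IsCubeModel P p ν X ρ) (hd : 0 < d) {T : ℕ}
    (hT : T = 1 ∨ 2 ≤ d) {c : ℝ} (hc : ∀ᶠ k : ℕ in atTop, c ≤ k * ν.real (Set.Ici k))
    (hdT : (d : ℝ) < T * p * c) :
    ∀ᵐ ω ∂P, EventuallyDoublyCovered (fun i => X i ω) (fun i => ρ i ω) := by
  obtain ⟨K, hK⟩ := eventually_atTop.1 ((hc.and (eventually_gt_atTop 0)).and
    (eventually_ge_atTop T))
  have hd0 : (0 : ℝ) < d := by exact_mod_cast hd
  set A : ℝ := T * p * c with hA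
  have hA0 : 0 < A := hd0.trans hdT
  have hc0 : 0 < c := pos_of_mul_pos_right hA0 (mul_nonneg (Nat.cast_nonneg T) p.2.1)
  -- The gap `A - d` is halved: `(1 - θ) * A = (A + d) / 2 = d * r`, which leaves `r > 1`.
  obtain ⟨θ, hθ, hθA⟩ : ∃ θ > 0, θ * A = (A - d) / 2 :=
    ⟨(A - d) / 2 / A, by have := sub_pos.2 hdT; positivity, div_mul_cancel₀ _ hA0.ne'⟩
  have hθ1 : θ ≤ 1 := by nlinarith
  obtain ⟨r, hr, hrA⟩ : ∃ r : ℝ, 1 < r ∧ d * r = (A + d) / 2 :=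
    ⟨(A + d) / 2 / d, by rw [lt_div_iff₀ hd0]; linarith, mul_div_cancel₀ _ hd0.ne'⟩
  set C : ℝ := θ⁻¹ * (K : ℝ) ^ (d * r) with hC
  have hC0 : 0 ≤ C := by positivity
  let s : Site d → Set Ω := fun m => {ω | (∀ a, K ≤ m a) ∧
    ¬ ∃ i j, i ≠ j ∧ SiteCovers (fun i => X i ω) (fun i => ρ i ω) i m ∧
        SiteCovers (fun i => X i ω) (fun i => ρ i ω) j m}
  have hs : ∀ m, P (s m) ≤ ENNReal.ofReal C * ∏ a, ENNReal.ofReal ((m a : ℝ) ^ (-r)) := by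
    intro m
    by_cases hm : ∀ a, K ≤ m a
    · have h1 := h.measureReal_not_doublyCovered_le hd hT hc0.le (hK K le_rfl).1.2 (hK K le_rfl).2
        (fun k hk => (hK k hk).1.1) hθ hθ1 (r := r) (by linarith)
        (by rw [hrA, ← hA]; linarith) m hm
      rw [← ENNReal.ofReal_prod_of_nonneg (fun _ _ => by positivity), ← ENNReal.ofReal_mul hC0,
        ← ENNReal.ofReal_toReal (measure_ne_top P (s m))]
      refine ENNReal.ofReal_le_ofReal (le_trans (measureReal_mono fun ω hω => hω.2) h1)
    · have : s m = ∅ := by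
        ext ω
        simp [s, hm]
      simp [this]
  have hsum : ∑' m, P (s m) ≠ ∞ := by
    refine ne_top_of_le_ne_top ?_ (ENNReal.tsum_le_tsum hs)
    rw [ENNReal.tsum_mul_left]
    refine ENNReal.mul_ne_top ENNReal.ofReal_ne_top ?_
    rw [ENNReal.tsum_pi_prod fun n : ℕ+ => ENNReal.ofReal ((n : ℝ) ^ (-r))]
    exact ENNReal.pow_ne_top (ENNReal.tsum_pnat_rpow_ne_top hr)
  filter_upwards [ae_finite_setOfPred_mem hsum] with ω hω
  let k0 : Fin d := ⟨0, hd⟩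
  -- Finitely many points are exceptional, so bounding one coordinate suffices to avoid them; adding
  -- `K` puts all coordinates in the range of the estimate.
  obtain ⟨b, hb⟩ := (hω.image fun m => m k0).bddAbove
  refine ⟨fun _ => b + K.succPNat, fun n => add_mem_doublyCovered_iff.2 ?_⟩
  by_contra hcon
  have h1 : ((fun _ => b + K.succPNat) + n : Site d) ∈ {i | ω ∈ s i} := by
    refine ⟨fun a => ?_, hcon⟩
    simp only [Pi.add_apply, PNat.add_coe, Nat.succPNat_coe]
    omega
  have h2 := hb (Set.mem_image_of_mem _ h1)
  have h3 : (((b + K.succPNat + n k0 : ℕ+)) : ℕ) ≤ b := by exact_mod_cast h2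
  simp only [PNat.add_coe, Nat.succPNat_coe] at h3
  omega

end IsCubeModel

/-! ### Uncovered points along a strip. -/

/-- The site whose coordinate `k0` is `n + 1` and whose other coordinates are `b + 1`. -/
def stripSite {d : ℕ} (k0 : Fin d) {s : ℕ} (x : ℕ × ({k : Fin d // k ≠ k0} → Fin s)) : Site d :=
  fun k => if h : k = k0 then x.1.succPNat else (x.2 ⟨k, h⟩ : ℕ).succPNat

theorem stripSite_injective {d : ℕ} (k0 : Fin d) {s : ℕ} :
    Function.Injective (stripSite k0 (s := s)) := by
  intro x y hxy
  refine Prod.ext ?_ (funext fun k => Fin.ext ?_)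
  · simpa [stripSite] using congrFun hxy k0
  · simpa [stripSite, k.2] using congrFun hxy k

namespace IsCubeModel

variable {Ω : Type*} [MeasurableSpace Ω] {P : Measure Ω} [IsProbabilityMeasure P]
  {d : ℕ} {p : I} {ν : Measure ℕ} [IsProbabilityMeasure ν] {X ρ : Site d → Ω → ℕ}

/-- Along a line at height `s` parallel to the axis `k0`, infinitely many lattice points are
uncovered, provided that the tail of `ρ` is small compared with the section of the strip. -/
theorem ae_exists_not_siteCovers (h : IsCubeModel P p ν X ρ) (hp : p < 1) (k0 : Fin d) (s : ℕ)
    (hs : ∀ᶠ k : ℕ in atTop,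
      (s : ℝ) ^ (d - 1) * p * (k * ν.real (Set.Ici k)) ≤ 1) :
    ∀ᵐ ω ∂P, ∀ N, ∃ n, N ≤ n ∧ ∀ m : Site d, (m k0 : ℕ) = n + 1 → (∀ k ≠ k0, (m k : ℕ) = s) →
      ∀ i, ¬ SiteCovers (fun i => X i ω) (fun i => ρ i ω) i m := by
  classical
  let κ := {k : Fin d // k ≠ k0} → Fin s
  let μ := (bernoulliMeasure (1 : ℕ) 0 p).prod ν
  -- The `+ 1` turns closed cubes into the half-open intervals `[n, n + R n)`; a slice without open
  -- sites has reach `0`.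
  let reach : (κ → ℕ × ℕ) → ℕ := fun z =>
    Finset.univ.sup fun b => if (z b).1 = 1 then (z b).2 + 1 else 0
  have hreach : Measurable reach := Measurable.of_discrete
  have hgroup := iIndepFun_curry (P := P) (μ := μ)
    (Z := fun x : ℕ × κ => fun ω => (X (stripSite k0 x) ω, ρ (stripSite k0 x) ω))
    (fun x => h.measurable_pair _) (fun x => h.map_pair _)
    (h.iIndepFun_pair.precomp (stripSite_injective k0))
  let R : ℕ → Ω → ℕ := fun n ω =>
    reach fun b => (X (stripSite k0 (n, b)) ω, ρ (stripSite k0 (n, b)) ω)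
  have hRm : ∀ n, Measurable (R n) := fun n => hreach.comp
    (measurable_pi_lambda _ fun b => h.measurable_pair _)
  let π : Measure (κ → ℕ × ℕ) := Measure.infinitePi fun _ => μ
  have : IsProbabilityMeasure (π.map reach) := Measure.isProbabilityMeasure_map hreach.aemeasurable
  have hlaw : ∀ n, P.map (R n) = π.map reach := by
    intro n
    rw [show π = _ from (hgroup.2 n).symm,
      Measure.map_map hreach (measurable_pi_lambda _ fun b => h.measurable_pair _)]
    rfl
  have hind : iIndepFun R P := hgroup.1.comp (fun _ => reach) fun _ => hreach
  -- Since `p < 1`, all the finitely many sites of a slice are closed with positive probability.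
  have h0 : 0 < π.map reach {0} := by
    rw [Measure.map_apply hreach MeasurableSet.of_discrete]
    have hsub : Set.univ.pi (fun _ => {0} ×ˢ Set.univ) ⊆ reach ⁻¹' {0} := by
      intro z hz
      simp only [Set.mem_pi, Set.mem_univ, true_imp_iff, Set.mem_prod, Set.mem_singleton_iff,
        and_true] at hz
      simp [reach, hz]
    refine lt_of_lt_of_le ?_ (measure_mono hsub)
    rw [show π = _ from Measure.infinitePi_eq_pi _, Measure.pi_pi]
    refine CanonicallyOrderedAdd.prod_pos.2 fun b _ => ?_
    have hb : bernoulliMeasure (1 : ℕ) 0 p {0} = unitInterval.toNNReal (unitInterval.symm p) := by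
      rw [bernoulliMeasure_apply_of_notMem_of_mem] <;> simp
    rw [Measure.prod_prod, hb, measure_univ, mul_one]
    rw [ENNReal.coe_pos, ← NNReal.coe_pos]
    simpa using hp
  have h1 : ∀ᶠ k : ℕ in atTop, (k : ℝ) * (π.map reach).real (Set.Ioi k) ≤ 1 := by
    filter_upwards [hs] with k hk
    have hsub : reach ⁻¹' Set.Ioi k ⊆ ⋃ b, (fun z => z b) ⁻¹' ({1} ×ˢ Set.Ici k) := by
      intro z hz
      simp only [reach, Set.mem_preimage, Set.mem_Ioi, Finset.lt_sup_iff, Finset.mem_univ,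
        true_and] at hz
      obtain ⟨b, hb⟩ := hz
      refine Set.mem_iUnion.2 ⟨b, ?_⟩
      split_ifs at hb with hb1
      · exact ⟨hb1, by simp only [Set.mem_Ici]; omega⟩
      · omega
    have hev : ∀ b, π.real ((fun z => z b) ⁻¹' ({1} ×ˢ Set.Ici k)) = p * ν.real (Set.Ici k) := by
      intro b
      rw [← map_measureReal_apply (measurable_pi_apply b) MeasurableSet.of_discrete,
        Measure.infinitePi_map_eval, bernoulliMeasure_prod_real]
    have hcard : Fintype.card κ = s ^ (d - 1) := by
      simp [κ, Fintype.card_subtype_compl]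
    have : (π.map reach).real (Set.Ioi k) ≤ (s : ℝ) ^ (d - 1) * (p * ν.real (Set.Ici k)) := by
      rw [map_measureReal_apply hreach MeasurableSet.of_discrete]
      refine (measureReal_mono hsub).trans ((measureReal_iUnion_fintype_le _).trans ?_)
      simp_rw [hev]
      simp [hcard]
    calc _ ≤ (k : ℝ) * ((s : ℝ) ^ (d - 1) * (p * ν.real (Set.Ici k))) := by gcongr
      _ ≤ 1 := by linarith
  filter_upwards [ae_exists_uncovered hRm hlaw hind h0 h1] with ω hω N
  obtain ⟨n, hn, hR⟩ := hω N
  refine ⟨n, hn, fun m hm0 hm i ⟨hXi, hi⟩ => ?_⟩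
  have hi0 := hi k0
  -- A site covering `m` has coordinates at most those of `m`, hence lies in the strip.
  let x : ℕ × κ := ((i k0).natPred, fun k => ⟨(i k).natPred, by
    have h1 := hi k
    have h2 := hm k k.2
    have h3 := (i k).natPred_add_one
    omega⟩)
  have hx : stripSite k0 x = i := by
    funext k
    by_cases hk : k = k0
    · subst hk
      simp [stripSite, x]
    · simp [stripSite, x, hk]
  have h3 := (i k0).natPred_add_one
  have h4 := hR x.1 (by simp only [x]; omega)
  have h5 : ρ i ω + 1 ≤ R x.1 ω := by
    refine le_trans ?_ (Finset.le_sup (Finset.mem_univ x.2))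
    simp only [Prod.mk.eta, hx]
    simp [hXi]
  have h6 : (m k0 : ℕ) ≤ i k0 + ρ i ω := hi0.2
  simp only [x] at h4 h5
  omega

theorem ae_not_eventuallyDoublyCovered (h : IsCubeModel P p ν X ρ) (hp : p < 1) (hd : 0 < d)
    (hs : ∀ s : ℕ, ∀ᶠ k : ℕ in atTop,
      (s : ℝ) ^ (d - 1) * p * (k * ν.real (Set.Ici k)) ≤ 1) :
    ∀ᵐ ω ∂P, ¬ EventuallyDoublyCovered (fun i => X i ω) (fun i => ρ i ω) := by
  let k0 : Fin d := ⟨0, hd⟩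
  filter_upwards [ae_all_iff.2 fun s => h.ae_exists_not_siteCovers hp k0 s (hs s)] with ω hω
  rintro ⟨t, ht⟩
  have htT : ∀ k, (t k : ℕ) ≤ ∑ k, (t k : ℕ) := fun k =>
    Finset.single_le_sum (f := fun k => (t k : ℕ)) (fun _ _ => Nat.zero_le _) (Finset.mem_univ k)
  -- The line at height `T + 1` exceeds every coordinate of `t`. As `t` is random, all heights were
  -- treated simultaneously.
  set T := ∑ k, (t k : ℕ)
  obtain ⟨n, hn, hno⟩ := hω (T + 1) T
  let m : Site d := fun k => if k = k0 then n.succPNat else T.succPNat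
  have hmt : ∀ k, t k < m k := by
    intro k
    rw [← PNat.coe_lt_coe]
    have := htT k
    simp only [m]
    split_ifs <;> simp only [Nat.succPNat_coe] <;> omega
  have hm : t + (fun k => m k - t k) = m := funext fun k => PNat.add_sub_of_lt (hmt k)
  obtain ⟨i, -, -, hi, -⟩ := add_mem_doublyCovered_iff.1 (ht fun k => m k - t k)
  rw [hm] at hi
  exact hno m (by simp [m]) (fun k hk => by simp [m, hk]) i hi

end IsCubeModel

/-! ### From limits of the scaled tail to the theorem. -/

theorem scaledTail_eq_ofReal (ν : Measure ℕ) [IsProbabilityMeasure ν] (k : ℕ) :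
    scaledTail ν k = ENNReal.ofReal (k * ν.real (Set.Ici k)) := by
  rw [ENNReal.ofReal_mul (Nat.cast_nonneg k), ENNReal.ofReal_natCast, measureReal_def,
    ENNReal.ofReal_toReal (measure_ne_top _ _), scaledTail]

/-- Real numbers below the lower limit of the scaled tail bound the scaled tail from below. -/
theorem eventually_le_of_lt_liminf_scaledTail {ν : Measure ℕ} [IsProbabilityMeasure ν] {c : NNReal}
    (hc : (c : ℝ≥0∞) < liminf (scaledTail ν) atTop) :
    ∀ᶠ k : ℕ in atTop, (c : ℝ) ≤ k * ν.real (Set.Ici k) := by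
  filter_upwards [eventually_lt_of_lt_liminf hc] with k hk
  rw [scaledTail_eq_ofReal, ← ENNReal.ofReal_coe_nnreal] at hk
  exact (ENNReal.ofReal_lt_ofReal_iff'.1 hk).1.le

theorem mainTheorem1 {Ω : Type*} [MeasurableSpace Ω] (P : Measure Ω) [IsProbabilityMeasure P]
    (d : ℕ) (p : I) (ν : Measure ℕ) [IsProbabilityMeasure ν]
    (X ρ : Site d → Ω → ℕ) (h : IsCubeModel P p ν X ρ) :
    (d = 1 → 1 < liminf (scaledTail ν) atTop → limsup (scaledTail ν) atTop < ∞ →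
      (1 / liminf (scaledTail ν) atTop < ENNReal.ofReal p →
        P {ω | EventuallyDoublyCovered (fun i => X i ω) (fun i => ρ i ω)} = 1) ∧
      (ENNReal.ofReal p < 1 / limsup (scaledTail ν) atTop →
        P {ω | EventuallyDoublyCovered (fun i => X i ω) (fun i => ρ i ω)} = 0)) ∧
    (2 ≤ d → 0 < p →
      (0 < liminf (scaledTail ν) atTop →
        P {ω | EventuallyDoublyCovered (fun i => X i ω) (fun i => ρ i ω)} = 1) ∧
      (p < 1 → Tendsto (scaledTail ν) atTop (𝓝 0) →
        P {ω | EventuallyDoublyCovered (fun i => X i ω) (fun i => ρ i ω)} = 0)) := by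
  refine ⟨fun hd hl hL => ⟨fun hp => ?_, fun hp => ?_⟩,
    fun hd hp0 => ⟨fun hl => ?_, fun hp1 hlim => ?_⟩⟩
  · have hp0 : (0 : ℝ) < p := ENNReal.ofReal_pos.1 (bot_le.trans_lt hp)
    rw [one_div, ENNReal.inv_lt_iff_inv_lt] at hp
    obtain ⟨c, hpc, hcl⟩ := ENNReal.lt_iff_exists_nnreal_btwn.1 hp
    rw [← ENNReal.ofReal_inv_of_pos hp0, ← ENNReal.ofReal_coe_nnreal] at hpc
    rw [measure_congr (eventuallyEq_univ.2 (h.ae_eventuallyDoublyCovered (T := 1) (by omega)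
      (Or.inl rfl) (eventually_le_of_lt_liminf_scaledTail hcl) ?_)), measure_univ]
    have hpc' := (ENNReal.ofReal_lt_ofReal_iff'.1 hpc).1
    rw [inv_lt_iff_one_lt_mul₀' hp0] at hpc'
    simpa [hd] using hpc'
  · rw [measure_eq_zero_iff_ae_notMem]
    have hLp : limsup (scaledTail ν) atTop < (ENNReal.ofReal p)⁻¹ := by
      rwa [one_div, ENNReal.lt_inv_iff_lt_inv] at hp
    -- From `1 < l ≤ L < 1 / p`.
    have hp1 : p < 1 := by
      have h1 : 1 < (ENNReal.ofReal p)⁻¹ := (hl.trans_le (liminf_le_limsup)).trans hLp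
      rw [ENNReal.one_lt_inv, ENNReal.ofReal_lt_one] at h1
      exact h1
    refine h.ae_not_eventuallyDoublyCovered hp1 (by omega) fun s => ?_
    filter_upwards [eventually_lt_of_limsup_lt hLp] with k hk
    subst hd
    rcases eq_or_lt_of_le p.2.1 with h0 | h0
    · simp [← h0]
    rw [scaledTail_eq_ofReal, ← ENNReal.ofReal_inv_of_pos h0,
      ENNReal.ofReal_lt_ofReal_iff (inv_pos.2 h0), inv_eq_one_div, lt_div_iff₀' h0] at hk
    simpa using hk.le
  · obtain ⟨c, hc0, hcl⟩ := ENNReal.lt_iff_exists_nnreal_btwn.1 hl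
    have hc0' : (0 : ℝ) < c := by exact_mod_cast hc0
    have hp0' : (0 : ℝ) < p := hp0
    -- With a second axis, `T` can be chosen so that `T * p * c > d`, however small `p * c` is.
    obtain ⟨T, hT⟩ := exists_nat_gt ((d : ℝ) / (p * c))
    rw [measure_congr (eventuallyEq_univ.2 (h.ae_eventuallyDoublyCovered (T := T) (by omega)
      (Or.inr hd) (eventually_le_of_lt_liminf_scaledTail hcl) ?_)), measure_univ]
    rwa [div_lt_iff₀ (by positivity), ← mul_assoc] at hT
  · rw [measure_eq_zero_iff_ae_notMem]
    refine h.ae_not_eventuallyDoublyCovered hp1 (by omega) fun s => ?_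
    set a : ℝ := (s : ℝ) ^ (d - 1) * p
    have h1 : Tendsto (fun k : ℕ => a * (k * ν.real (Set.Ici k))) atTop (𝓝 (a * 0)) := by
      refine Tendsto.const_mul a ?_
      have h2 := (ENNReal.tendsto_toReal ENNReal.zero_ne_top).comp hlim
      refine h2.congr fun k => ?_
      simp [scaledTail, measureReal_def]
    rw [mul_zero] at h1
    exact (h1.eventually_lt_const one_pos).mono fun k hk => hk.le
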